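/- There are universal constants $c_l, c_u > 0$ such that the following holds for all $n \ge 1$ and all privacy levels $0 \le \varepsilon_1 \le \dots \le \varepsilon_n \le 1$. Let $\mathcal X = [-\tfrac12,\tfrac12]$. Call a randomized estimator $\hat\theta$ (a Markov kernel from $\mathcal X^n$ to $\mathbb R$) $\varepsilon$-centrally differentially private if $\mathbb P(\hat\theta(S)\in W) \le e^{\varepsilon_i}\,\mathbb P(\hat\theta(S')\in W)$ for every $i$, all $S,S'\in\mathcal X^n$ that differ only in the $i$-th entry, and every measurable $W \subseteq \mathbb R$; let $\mathcal Q_c(\varepsilon)$ be the class of these estimators. For a probability distribution $P$ on $\mathcal X$ with mean $\theta(P)$ put $$R(\hat\theta,P)=\mathbb E\big[|\hat\theta(X_{1:n})-\theta(P)|^2\big],$$ where $X_1,\dots,X_n$ are i.i.d. with law $P$ and the expectation is over the data and the randomness of the estimator. Let $$M(\varepsilon)=\max_{0\le k\le n}\frac{1}{n-k+\big(\sum_{i=1}^k\varepsilon_i\big)^2}\in(0,\infty]\qquad(1/0=\infty).$$ Lower bound: $$\inf_{\hat\theta\in\mathcal Q_c(\varepsilon)}\ \sup_P\ R(\hat\theta,P)\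 \ge\ c_l\,\min(1,M(\varepsilon)),$$ where the supremum is over all probability distributions $P$ on $\mathcal X$. Upper bound: (i) If $\varepsilon_n>0$, there is $\hat\theta\in\mathcal Q_c(\varepsilon)$ of the form $\hat\theta(x)=\sum_{i=1}^n w_i x_i+\mathrm{Laplace}(1/\eta)$ with $\eta>0$ and $\sum_i w_i=1$ (where $\mathrm{Laplace}(b)$ has density $\frac1{2b}e^{-|z|/b}$), whose weights are capped at a common level, $w_i=\min(\varepsilon_i,\tau)/\eta$ for some $\tau>0$, such that $R(\hat\theta,P)\le c_u\log(n+1)\,M(\varepsilon)$ for every $P$ on $\mathcal X$. (ii) In all cases there is $\hat\theta\in\mathcal Q_c(\varepsilon)$ which is either of this form or identically $0$ (the degenerate linear estimator with zero weights and no noise), such that $R(\hat\theta,P)\le c_u\log(n+1)\,\min(1,M(\varepsilon))$ for every $P$ on $\mathcal X$. -/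

import Mathlib

open MeasureTheory ProbabilityTheory
open scoped ENNReal

namespace CentralDP

/-- The data space of one user: the interval `[-1/2, 1/2]`. -/
abbrev Data : Type := Set.Icc (-(1 / 2) : ℝ) (1 / 2)

/-- A randomized algorithm (a Markov kernel from data sets of size `n` to the reals) is
`ε`-centrally differentially private if, for every user `i`, any two data sets which differ
at most in the `i`-th entry have output laws within a factor `exp (ε i)` of each other. -/
def IsCentrallyDP {n : ℕ} (ε : Fin n → ℝ) (A : Kernel (Fin n → Data) ℝ) : Prop :=
  ∀ (i : Fin n) (S S' : Fin n → Data), (∀ j, j ≠ i → S j = S' j) →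
    ∀ W : Set ℝ, MeasurableSet W → A S W ≤ ENNReal.ofReal (Real.exp (ε i)) * A S' W

/-- The class of `ε`-centrally differentially private estimators. -/
def privateEstimators {n : ℕ} (ε : Fin n → ℝ) : Set (Kernel (Fin n → Data) ℝ) :=
  {A | IsMarkovKernel A ∧ IsCentrallyDP ε A}

/-- The mean of a distribution on the data space. -/
noncomputable def mean (P : ProbabilityMeasure Data) : ℝ := ∫ x, (x : ℝ) ∂(P : Measure Data)

/-- The expected squared error of the randomized estimator `A` of the mean when the `n` data
points are independent with law `P`; the expectation is over the data and over the
randomness of the estimator. -/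
noncomputable def risk {n : ℕ} (A : Kernel (Fin n → Data) ℝ) (P : ProbabilityMeasure Data) :
    ℝ≥0∞ :=
  ∫⁻ x, ∫⁻ t, ENNReal.ofReal (|t - mean P| ^ 2) ∂(A x)
    ∂(Measure.pi fun _ : Fin n => (P : Measure Data))

/-- The minimax squared error over the family `F` under `ε`-central differential privacy. -/
noncomputable def minimaxRisk {n : ℕ} (F : Set (ProbabilityMeasure Data)) (ε : Fin n → ℝ) :
    ℝ≥0∞ :=
  ⨅ A ∈ privateEstimators ε, ⨆ P ∈ F, risk A P

/-- The centred Laplace distribution with scale `b` (meant for `b > 0`). -/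
noncomputable def laplace (b : ℝ) : Measure ℝ :=
  volume.withDensity fun z => ENNReal.ofReal (1 / (2 * b) * Real.exp (-|z| / b))

/-- On input `x`, the algorithm `A` outputs `∑ i, w i * x i` plus Laplace noise of
scale `1 / η`. -/
def IsLinearLaplace {n : ℕ} (w : Fin n → ℝ) (η : ℝ) (A : Kernel (Fin n → Data) ℝ) : Prop :=
  0 < η ∧ ∀ x, A x = (laplace (1 / η)).map fun z => (∑ i, w i * (x i : ℝ)) + z

/-- `A` is a weighted average of the data plus Laplace noise of scale `1 / η`, in which the
weights are proportional to the privacy levels capped at a common level `τ`: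
`w i = min (ε i) τ / η`. -/
def IsCappedLinearLaplace {n : ℕ} (ε : Fin n → ℝ) (A : Kernel (Fin n → Data) ℝ) : Prop :=
  ∃ (w : Fin n → ℝ) (η τ : ℝ), 0 < τ ∧ ∑ i, w i = 1 ∧ (∀ i, w i = min (ε i) τ / η) ∧
    IsLinearLaplace w η A

/-- `max_{0 ≤ k ≤ n} 1 / (n - k + (ε_1 + ⋯ + ε_k) ^ 2)`, where `1 / 0 = ∞`. -/
noncomputable def rate {n : ℕ} (ε : Fin n → ℝ) : ℝ≥0∞ :=
  ⨆ k : Fin (n + 1),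
    (ENNReal.ofReal ((n : ℝ) - (k : ℕ) + (∑ i ∈ Finset.univ.filter fun i : Fin n => (i : ℕ) < k, ε i) ^ 2))⁻¹

end CentralDP

/-! Lower bound: a two-point argument in which the users are split. For an index k, put D = n - k +
(ε_1 + ⋯ + ε_k)² and compare fair signs at the end points ±1/2 with signs of mean δ, where δ is of
order max(1, D)^(-1/2). The probability φ that the output exceeds δ/4 is a function of the sign
vector. Biasing one of the first k signs raises the expectation of φ by at most δ ε_i, since privacy
bounds the oscillation of φ in that coordinate. Biasing the other n - k signs is charged to the
second moment of the likelihood ratio, as if there were no privacy (`bitExp_const_sub_le`). Both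
costs are small, so the output cannot tell the two means apart and the risk is of order δ² under one
of them (`ofReal_le_iSup_risk`).

Upper bound: put m_i = min(ε_i, τ) and η = ∑ m_i. With weights m_i/η and noise scale 1/η the
estimator is private and its risk is at most (∑ m_i²/2 + 4)/η². The cap balances sampling against
noise: if ∑ m_i (τ - m_i) = 8, this bound equals τ/(2η), while the index k counting the levels at
most τ/2 has effective size at most 16η/τ (`exists_effectiveSize_le`). If no τ ≤ 1 balances because
privacy noise dominates, τ = 1 works (`exists_capping_level`). This gives the rate up to the
constant 72; the logarithm is only needed to be bounded below. -/

namespace CentralDP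

/-! ### Sign vectors under a product of biased coins -/

section SignVectors

variable {ι : Type*} [Fintype ι]

/-- The sign attached to a bit. -/
def bitSign (c : Bool) : ℝ := if c then 1 else -1

/-- The probability of the bit vector `b` when the bits are independent and the sign of the
`i`-th one has mean `a i`. -/
noncomputable def bitWeight (a : ι → ℝ) (b : ι → Bool) : ℝ :=
  ∏ i, (1 + a i * bitSign (b i)) / 2

/-- The expectation of `φ` under independent bits with sign means `a`. -/
noncomputable def bitExp [DecidableEq ι] (a : ι → ℝ) (φ : (ι → Bool) → ℝ) : ℝ :=
  ∑ b, bitWeight a b * φ b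

lemma bitSign_sq (c : Bool) : bitSign c ^ 2 = 1 := by cases c <;> simp [bitSign]

lemma abs_bitSign (c : Bool) : |bitSign c| = 1 := by cases c <;> simp [bitSign]

lemma bitSign_not (c : Bool) : bitSign (!c) = -bitSign c := by cases c <;> simp [bitSign]

lemma bitWeight_nonneg {a : ι → ℝ} (ha : ∀ i, |a i| ≤ 1) (b : ι → Bool) :
    0 ≤ bitWeight a b := by
  refine Finset.prod_nonneg fun i _ => ?_
  have h : |a i * bitSign (b i)| ≤ 1 := by rw [abs_mul, abs_bitSign, mul_one]; exact ha i
  linarith [(abs_le.1 h).1]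

/-- Disjoint supports leave no cross term in any factor, so the extra product is the likelihood
ratio of the two bit laws. -/
lemma bitWeight_add {a a' : ι → ℝ} (h : ∀ i, a i * a' i = 0) (b : ι → Bool) :
    bitWeight (a + a') b = bitWeight a b * ∏ i, (1 + a' i * bitSign (b i)) := by
  rw [bitWeight, bitWeight, ← Finset.prod_mul_distrib]
  refine Finset.prod_congr rfl fun i _ => ?_
  have := bitSign_sq (b i)
  simp only [Pi.add_apply]
  linear_combination (-(1 / 2) * bitSign (b i) ^ 2) * h i

variable [DecidableEq ι]

lemma sum_prod_bits (f : ι → Bool → ℝ) :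
    ∑ b : ι → Bool, ∏ i, f i (b i) = ∏ i, (f i true + f i false) := by
  have := Finset.prod_univ_sum (fun _ : ι => (Finset.univ : Finset Bool)) f
  rw [Fintype.piFinset_univ] at this
  rw [← this]
  simp

lemma sum_bitWeight (a : ι → ℝ) : ∑ b, bitWeight a b = 1 := by
  simp only [bitWeight]
  rw [sum_prod_bits fun i c => (1 + a i * bitSign c) / 2]
  refine Finset.prod_eq_one fun i _ => ?_
  simp only [bitSign, if_true, Bool.false_eq_true, if_false]
  ring

/-- The second moment of the likelihood ratio, that is, one plus its chi-square divergence;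
independence makes it a product. -/
lemma sum_bitWeight_mul_sq {a a' : ι → ℝ} (h : ∀ i, a i * a' i = 0) :
    ∑ b, bitWeight a b * (∏ i, (1 + a' i * bitSign (b i))) ^ 2 = ∏ i, (1 + a' i ^ 2) := by
  simp only [bitWeight, ← Finset.prod_pow, ← Finset.prod_mul_distrib]
  rw [sum_prod_bits fun i c => (1 + a i * bitSign c) / 2 * (1 + a' i * bitSign c) ^ 2]
  refine Finset.prod_congr rfl fun i _ => ?_
  simp only [bitSign, if_true, Bool.false_eq_true, if_false]
  linear_combination 2 * h i

/-- Biasing a single fair bit moves the expectation of `φ` by at most the oscillation of `φ`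
in that bit. -/
lemma bitExp_add_single_sub_le {a : ι → ℝ} (ha : ∀ i, |a i| ≤ 1) {i : ι} (hi : a i = 0)
    {δ r : ℝ} (hδ : 0 ≤ δ) {φ : (ι → Bool) → ℝ}
    (hφ : ∀ b c, |φ b - φ (Function.update b i c)| ≤ r) :
    bitExp (a + Pi.single i δ) φ - bitExp a φ ≤ δ / 2 * r := by
  have hdis : ∀ j, a j * (Pi.single i δ : ι → ℝ) j = 0 := by
    intro j
    by_cases h : j = i
    · subst h; simp [hi]
    · simp [h]
  have hG : ∀ b : ι → Bool,
      ∏ j, (1 + (Pi.single i δ : ι → ℝ) j * bitSign (b j)) = 1 + δ * bitSign (b i) := by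
    intro b
    rw [Finset.prod_eq_single i]
    · simp
    · intro j _ hj; simp [hj]
    · simp
  have hdiff : bitExp (a + Pi.single i δ) φ - bitExp a φ
      = δ * ∑ b, bitWeight a b * bitSign (b i) * φ b := by
    rw [bitExp, bitExp, ← Finset.sum_sub_distrib, Finset.mul_sum]
    refine Finset.sum_congr rfl fun b _ => ?_
    rw [bitWeight_add hdis, hG]
    ring
  -- Bit i is fair under `a`, so flipping it preserves the weights; averaging a sum with its flipped
  -- copy turns `φ` into a difference.
  let flip : (ι → Bool) → ι → Bool := fun b => Function.update b i (!b i)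
  have hinv : Function.Involutive flip := by intro b; simp [flip]
  have hflip : ∑ b, bitWeight a b * bitSign (b i) * φ b
      = ∑ b, bitWeight a b * (-bitSign (b i)) * φ (flip b) := by
    rw [← Equiv.sum_comp hinv.toPerm]
    refine Finset.sum_congr rfl fun b _ => ?_
    have hw : bitWeight a (flip b) = bitWeight a b := by
      refine Finset.prod_congr rfl fun j _ => ?_
      by_cases h : j = i
      · subst h; simp [hi]
      · simp [flip, h]
    simp only [Function.Involutive.coe_toPerm, hw]
    simp [flip, bitSign_not]
  have hle : 2 * ∑ b, bitWeight a b * bitSign (b i) * φ b ≤ r := by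
    calc 2 * ∑ b, bitWeight a b * bitSign (b i) * φ b
        = ∑ b, bitWeight a b * (bitSign (b i) * (φ b - φ (flip b))) := by
          rw [two_mul]
          nth_rw 2 [hflip]
          rw [← Finset.sum_add_distrib]
          exact Finset.sum_congr rfl fun b _ => by ring
      _ ≤ ∑ b, bitWeight a b * r := by
          refine Finset.sum_le_sum fun b _ =>
            mul_le_mul_of_nonneg_left ((le_abs_self _).trans ?_) (bitWeight_nonneg ha b)
          rw [abs_mul, abs_bitSign, one_mul]
          exact hφ b _
      _ = r := by rw [← Finset.sum_mul, sum_bitWeight, one_mul]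
  rw [hdiff]
  nlinarith

/-- Biasing a set of fair bits moves the expectation of `φ` by at most the total oscillation
of `φ` in these bits. -/
lemma bitExp_indicator_sub_le {δ : ℝ} (hδ : 0 ≤ δ) (hδ1 : δ ≤ 1) {r : ι → ℝ}
    {φ : (ι → Bool) → ℝ} (s : Finset ι)
    (hφ : ∀ i ∈ s, ∀ b c, |φ b - φ (Function.update b i c)| ≤ r i) :
    bitExp (fun i => if i ∈ s then δ else 0) φ - bitExp 0 φ ≤ δ / 2 * ∑ i ∈ s, r i := by
  induction s using Finset.induction_on with
  | empty =>
    have : (fun i : ι => if i ∈ (∅ : Finset ι) then δ else 0) = 0 := by ext; simp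
    rw [this]
    simp
  | insert i s his ih =>
    have h1 := ih fun j hj => hφ j (Finset.mem_insert_of_mem hj)
    have heq : (fun j => if j ∈ insert i s then δ else 0)
        = (fun j => if j ∈ s then δ else 0) + Pi.single i δ := by
      ext j
      by_cases h : j = i
      · subst h; simp [his]
      · simp [h]
    have h2 := bitExp_add_single_sub_le (a := fun j => if j ∈ s then δ else 0) (i := i)
      (fun j => by by_cases h : j ∈ s <;> simp [h, abs_of_nonneg hδ, hδ1]) (by simp [his]) hδ
      (hφ i (Finset.mem_insert_self i s))
    rw [heq, Finset.sum_insert his]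
    linarith

/-- A second-moment bound on the change of expectation when fair bits are biased. -/
lemma bitExp_add_sub_le {a a' : ι → ℝ} (ha : ∀ i, |a i| ≤ 1) (h : ∀ i, a i * a' i = 0)
    {φ : (ι → Bool) → ℝ} (hφ : ∀ b, |φ b| ≤ 1) :
    bitExp (a + a') φ - bitExp a φ ≤ 1 / 8 + 2 * (∏ i, (1 + a' i ^ 2) - 1) := by
  set G : (ι → Bool) → ℝ := fun b => ∏ i, (1 + a' i * bitSign (b i)) with hG
  have h1 : ∑ b, bitWeight a b * G b = 1 := by
    rw [← sum_bitWeight (a + a')]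
    exact Finset.sum_congr rfl fun b _ => (bitWeight_add h b).symm
  have h2 : ∑ b, bitWeight a b * G b ^ 2 = ∏ i, (1 + a' i ^ 2) := sum_bitWeight_mul_sq h
  calc bitExp (a + a') φ - bitExp a φ = ∑ b, bitWeight a b * ((G b - 1) * φ b) := by
        rw [bitExp, bitExp, ← Finset.sum_sub_distrib]
        refine Finset.sum_congr rfl fun b _ => ?_
        rw [bitWeight_add h]
        ring
    _ ≤ ∑ b, bitWeight a b * (1 / 8 + 2 * (G b - 1) ^ 2) := by
        refine Finset.sum_le_sum fun b _ =>
          mul_le_mul_of_nonneg_left ?_ (bitWeight_nonneg ha b)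
        -- The inequality xy ≤ 2x² + y²/8 replaces Cauchy–Schwarz and avoids a square root; the 1/8
        -- is an affordable loss.
        nlinarith [sq_nonneg (4 * (G b - 1) - φ b), (sq_le_one_iff_abs_le_one _).2 (hφ b)]
    _ = (1 / 8 + 2) * ∑ b, bitWeight a b + 2 * ∑ b, bitWeight a b * G b ^ 2
          - 4 * ∑ b, bitWeight a b * G b := by
        simp only [Finset.mul_sum, ← Finset.sum_add_distrib, ← Finset.sum_sub_distrib]
        exact Finset.sum_congr rfl fun b _ => by ring
    _ = _ := by rw [h1, h2, sum_bitWeight]; ring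

/-- The change of the expectation of a test `φ` when all bits get the bias `δ`: the bits of
`s` are charged through the oscillation of `φ`, the others through the second moment. -/
lemma bitExp_const_sub_le {δ : ℝ} (hδ : 0 ≤ δ) (hδ1 : δ ≤ 1) {r : ι → ℝ}
    {φ : (ι → Bool) → ℝ} (hφ1 : ∀ b, |φ b| ≤ 1) (s : Finset ι)
    (hφ : ∀ i ∈ s, ∀ b c, |φ b - φ (Function.update b i c)| ≤ r i) :
    bitExp (fun _ => δ) φ - bitExp 0 φ
      ≤ δ / 2 * ∑ i ∈ s, r i + (1 / 8 + 2 * ((1 + δ ^ 2) ^ sᶜ.card - 1)) := by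
  -- The intermediate law biases only the bits of `s`.
  have h1 := bitExp_indicator_sub_le hδ hδ1 s hφ
  have h2 := bitExp_add_sub_le (a := fun i => if i ∈ s then δ else 0)
    (a' := fun i => if i ∈ s then 0 else δ)
    (fun j => by by_cases h : j ∈ s <;> simp [h, abs_of_nonneg hδ, hδ1])
    (fun i => by by_cases h : i ∈ s <;> simp [h]) hφ1
  have heq : (fun i => if i ∈ s then δ else 0) + (fun i => if i ∈ s then 0 else δ)
      = fun _ => δ := by
    ext i
    by_cases h : i ∈ s <;> simp [h]
  have hprod : ∏ i, (1 + (if i ∈ s then 0 else δ) ^ 2) = (1 + δ ^ 2) ^ sᶜ.card := by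
    rw [← Finset.prod_const, ← Finset.prod_mul_prod_compl s, Finset.prod_eq_one, one_mul]
    · exact Finset.prod_congr rfl fun i hi => by simp [Finset.mem_compl.1 hi]
    · intro i hi; simp [hi]
  rw [heq, hprod] at h2
  linarith

end SignVectors

/-! ### The Laplace distribution -/

section Laplace

lemma integral_abs_rpow_mul_exp {a r : ℝ} (ha : 0 < a) (hr : 0 < r) :
    ∫ z : ℝ, |z| ^ (a - 1) * Real.exp (-(r * |z|)) = 2 * ((1 / r) ^ a * Real.Gamma a) := by
  rw [← Real.integral_rpow_mul_exp_neg_mul_Ioi ha hr]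
  exact integral_comp_abs (f := fun t => t ^ (a - 1) * Real.exp (-(r * t)))

lemma lintegral_laplace_density_mul_sq {b : ℝ} (hb : 0 < b) :
    ∫⁻ z, ENNReal.ofReal (1 / (2 * b) * Real.exp (-|z| / b) * z ^ 2)
      = ENNReal.ofReal (2 * b ^ 2) := by
  have h := integral_abs_rpow_mul_exp (a := 3) (r := 1 / b) (by norm_num) (by positivity)
  have hG : Real.Gamma 3 = 2 := by norm_num [Nat.factorial]
  have hI : ∫ z : ℝ, 1 / (2 * b) * Real.exp (-|z| / b) * z ^ 2 = 2 * b ^ 2 := by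
    calc ∫ z : ℝ, 1 / (2 * b) * Real.exp (-|z| / b) * z ^ 2
        = ∫ z : ℝ, 1 / (2 * b) * (|z| ^ ((3 : ℝ) - 1) * Real.exp (-(1 / b * |z|))) := by
          congr 1 with z
          rw [show (3 : ℝ) - 1 = (2 : ℕ) by norm_num, Real.rpow_natCast, sq_abs,
            show -(1 / b * |z|) = -|z| / b by ring]
          ring
      _ = 2 * b ^ 2 := by
          rw [integral_const_mul, h, hG, one_div_one_div,
            show (3 : ℝ) = (3 : ℕ) by norm_num, Real.rpow_natCast]
          field_simp
  -- A Bochner integral is zero by convention for a non-integrable function, so its nonzero value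
  -- proves integrability.
  have hint : Integrable fun z : ℝ => 1 / (2 * b) * Real.exp (-|z| / b) * z ^ 2 :=
    Integrable.of_integral_ne_zero (by rw [hI]; positivity)
  rw [← hI, ofReal_integral_eq_lintegral_ofReal hint (.of_forall fun z => by positivity)]

lemma lintegral_laplace_density {b : ℝ} (hb : 0 < b) :
    ∫⁻ z, ENNReal.ofReal (1 / (2 * b) * Real.exp (-|z| / b)) = 1 := by
  have h := integral_abs_rpow_mul_exp (a := 1) (r := 1 / b) one_pos (by positivity)
  have hI : ∫ z : ℝ, 1 / (2 * b) * Real.exp (-|z| / b) = 1 := by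
    calc ∫ z : ℝ, 1 / (2 * b) * Real.exp (-|z| / b)
        = ∫ z : ℝ, 1 / (2 * b) * (|z| ^ ((1 : ℝ) - 1) * Real.exp (-(1 / b * |z|))) := by
          congr 1 with z
          rw [sub_self, Real.rpow_zero, one_mul, show -(1 / b * |z|) = -|z| / b by ring]
      _ = 1 := by
          rw [integral_const_mul, h, Real.Gamma_one, one_div_one_div, Real.rpow_one]
          field_simp
  have hint : Integrable fun z : ℝ => 1 / (2 * b) * Real.exp (-|z| / b) :=
    Integrable.of_integral_ne_zero (by rw [hI]; positivity)
  rw [← ofReal_integral_eq_lintegral_ofReal hint (.of_forall fun z => by positivity), hI,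
    ENNReal.ofReal_one]

lemma measurable_laplace_density (b : ℝ) :
    Measurable fun z : ℝ => ENNReal.ofReal (1 / (2 * b) * Real.exp (-|z| / b)) := by
  fun_prop

lemma isProbabilityMeasure_laplace {b : ℝ} (hb : 0 < b) : IsProbabilityMeasure (laplace b) :=
  ⟨by rw [laplace, withDensity_apply _ MeasurableSet.univ, Measure.restrict_univ,
    lintegral_laplace_density hb]⟩

lemma lintegral_sq_laplace {b : ℝ} (hb : 0 < b) :
    ∫⁻ z, ENNReal.ofReal (z ^ 2) ∂(laplace b) = ENNReal.ofReal (2 * b ^ 2) := by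
  rw [laplace, lintegral_withDensity_eq_lintegral_mul _ (measurable_laplace_density b)
    (by fun_prop), ← lintegral_laplace_density_mul_sq hb]
  refine lintegral_congr fun z => ?_
  rw [Pi.mul_apply, ← ENNReal.ofReal_mul (by positivity)]

lemma map_const_add_laplace_apply (b c : ℝ) {W : Set ℝ} (hW : MeasurableSet W) :
    (laplace b).map (fun z => c + z) W
      = ∫⁻ t in W, ENNReal.ofReal (1 / (2 * b) * Real.exp (-|t - c| / b)) := by
  have hm : MeasurableSet ((fun z => c + z) ⁻¹' W) := measurable_const_add c hW
  rw [Measure.map_apply (measurable_const_add c) hW, laplace, withDensity_apply _ hm,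
    ← lintegral_indicator hm, ← lintegral_indicator hW,
    ← lintegral_add_left_eq_self (μ := volume) (W.indicator _) c]
  refine lintegral_congr fun z => ?_
  by_cases h : c + z ∈ W <;> simp [Set.indicator, h]

/-- The law of shifted Laplace noise changes by a factor of at most `exp r` when the shift
moves by at most `r` times the scale. -/
lemma map_const_add_laplace_le {b : ℝ} (hb : 0 < b) {c c' r : ℝ} (h : |c - c'| ≤ r * b)
    {W : Set ℝ} (hW : MeasurableSet W) :
    (laplace b).map (fun z => c + z) W
      ≤ ENNReal.ofReal (Real.exp r) * (laplace b).map (fun z => c' + z) W := by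
  rw [map_const_add_laplace_apply _ _ hW, map_const_add_laplace_apply _ _ hW,
    ← lintegral_const_mul _ (by fun_prop)]
  refine lintegral_mono fun t => ?_
  dsimp only
  rw [← ENNReal.ofReal_mul (by positivity)]
  refine ENNReal.ofReal_le_ofReal ?_
  have h1 : |t - c'| ≤ |t - c| + r * b := by
    calc |t - c'| = |(t - c) + (c - c')| := by ring_nf
      _ ≤ |t - c| + |c - c'| := abs_add_le _ _
      _ ≤ _ := by linarith
  have h2 : -|t - c| / b ≤ r + -|t - c'| / b := by
    rw [div_le_iff₀ hb, add_mul, div_mul_cancel₀ _ hb.ne']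
    linarith
  calc 1 / (2 * b) * Real.exp (-|t - c| / b)
      ≤ 1 / (2 * b) * Real.exp (r + -|t - c'| / b) := by gcongr
    _ = _ := by rw [Real.exp_add]; ring

end Laplace

/-! ### Linear estimators with Laplace noise -/

section LinearLaplace

variable {n : ℕ}

/-- The kernel adding Laplace noise of scale `b` to a weighted sum of the data. -/
noncomputable def linearLaplace (w : Fin n → ℝ) (b : ℝ) : Kernel (Fin n → Data) ℝ :=
  ((Kernel.deterministic (fun x : Fin n → Data => ∑ i, w i * (x i : ℝ)) (by fun_prop)) ×ₖ
    Kernel.const _ (laplace b)).map fun p => p.1 + p.2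

lemma linearLaplace_apply (w : Fin n → ℝ) {b : ℝ} (hb : 0 < b) (x : Fin n → Data) :
    linearLaplace w b x = (laplace b).map fun z => (∑ i, w i * (x i : ℝ)) + z := by
  have := isProbabilityMeasure_laplace hb
  rw [linearLaplace, Kernel.map_apply _ (by fun_prop), Kernel.prod_apply,
    Kernel.deterministic_apply, Kernel.const_apply, Measure.dirac_prod,
    Measure.map_map (by fun_prop) (by fun_prop)]
  rfl

lemma isMarkovKernel_linearLaplace (w : Fin n → ℝ) {b : ℝ} (hb : 0 < b) :
    IsMarkovKernel (linearLaplace w b) :=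
  ⟨fun x => by
    have := isProbabilityMeasure_laplace hb
    rw [linearLaplace_apply w hb]
    exact Measure.isProbabilityMeasure_map (by fun_prop)⟩

/-- The data space has diameter 1, so user i moves the weighted sum by at most |w i|, to be compared
with the noise scale. -/
lemma isCentrallyDP_linearLaplace {w ε : Fin n → ℝ} {b : ℝ} (hb : 0 < b)
    (hw : ∀ i, |w i| ≤ ε i * b) : IsCentrallyDP ε (linearLaplace w b) := by
  intro i S S' hS W hW
  rw [linearLaplace_apply w hb, linearLaplace_apply w hb]
  refine map_const_add_laplace_le hb ?_ hW
  have hdiff : ∑ j, w j * (S j : ℝ) - ∑ j, w j * (S' j : ℝ) = w i * ((S i : ℝ) - S' i) := by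
    rw [← Finset.sum_sub_distrib, Finset.sum_eq_single i]
    · ring
    · intro j _ hj; rw [hS j hj, sub_self]
    · simp
  have hd : |(S i : ℝ) - S' i| ≤ 1 := by
    have h1 := (S i).2
    have h2 := (S' i).2
    rw [abs_le]
    constructor <;> linarith [h1.1, h1.2, h2.1, h2.2]
  rw [hdiff, abs_mul]
  calc |w i| * |(S i : ℝ) - S' i| ≤ |w i| * 1 := by gcongr
    _ ≤ _ := by rw [mul_one]; exact hw i

lemma mean_mem_Icc (P : ProbabilityMeasure Data) : mean P ∈ Set.Icc (-(1 / 2) : ℝ) (1 / 2) := by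
  have hint : Integrable (fun x : Data => (x : ℝ)) (P : Measure Data) :=
    Integrable.of_mem_Icc (-(1 / 2)) (1 / 2) (by fun_prop) (.of_forall fun x => x.2)
  constructor
  · simpa [mean] using integral_mono (integrable_const (-(1 / 2) : ℝ)) hint fun x => x.2.1
  · simpa [mean] using integral_mono hint (integrable_const (1 / 2 : ℝ)) fun x => x.2.2

/-- The noiseless weighted average of the data has squared error at most `∑ i, w i ^ 2 / 4`. -/
lemma lintegral_sq_weighted_sum_sub_mean_le {w : Fin n → ℝ} (hw : ∑ i, w i = 1)
    (P : ProbabilityMeasure Data) :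
    ∫⁻ x, ENNReal.ofReal ((∑ i, w i * (x i : ℝ) - mean P) ^ 2)
      ∂(Measure.pi fun _ : Fin n => (P : Measure Data))
      ≤ ENNReal.ofReal ((∑ i, w i ^ 2) / 4) := by
  set μ : Measure (Fin n → Data) := Measure.pi fun _ : Fin n => (P : Measure Data)
  have hL (i : Fin n) : MemLp (fun x : Data => w i * (x : ℝ)) 2 (P : Measure Data) := by
    refine MemLp.const_mul ?_ _
    exact memLp_of_bounded (a := -(1 / 2)) (b := 1 / 2) (.of_forall fun x => x.2)
      (by fun_prop) 2
  have hLpi (i : Fin n) : MemLp (fun x : Fin n → Data => w i * (x i : ℝ)) 2 μ :=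
    (hL i).comp_measurePreserving (measurePreserving_eval _ i)
  have hvar : Var[fun x : Fin n → Data => ∑ i, w i * (x i : ℝ); μ] ≤ (∑ i, w i ^ 2) / 4 := by
    have h := variance_sum_pi (μ := fun _ : Fin n => (P : Measure Data))
      (X := fun i (x : Data) => w i * (x : ℝ)) hL
    have heq : (∑ i, fun x : Fin n → Data => w i * (x i : ℝ))
        = fun x : Fin n → Data => ∑ i, w i * (x i : ℝ) := by
      ext x; simp
    rw [heq] at h
    rw [h, Finset.sum_div]
    refine Finset.sum_le_sum fun i _ => ?_
    rw [variance_const_mul]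
    have := variance_le_sq_of_bounded (μ := (P : Measure Data)) (X := fun x : Data => (x : ℝ))
      (.of_forall fun x => x.2) (by fun_prop)
    nlinarith [sq_nonneg (w i)]
  -- Weights summing to 1 make the average unbiased, so its squared error is its variance.
  have hmean : ∫ x, ∑ i, w i * (x i : ℝ) ∂μ = mean P := by
    rw [integral_finsetSum _ fun i _ => (hLpi i).integrable (by norm_num)]
    have (i : Fin n) : ∫ x, w i * (x i : ℝ) ∂μ = w i * mean P := by
      rw [integral_const_mul, mean]
      congr 1
      exact integral_comp_eval (μ := fun _ : Fin n => (P : Measure Data))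
        (f := fun x : Data => (x : ℝ)) (by fun_prop)
    simp only [this]
    rw [← Finset.sum_mul, hw, one_mul]
  rw [← hmean, ← evariance_eq_lintegral_ofReal,
    ← ofReal_variance (memLp_finsetSum _ fun i _ => hLpi i)]
  exact ENNReal.ofReal_le_ofReal hvar

lemma risk_linearLaplace_le {w : Fin n → ℝ} (hw : ∑ i, w i = 1) {b : ℝ} (hb : 0 < b)
    (P : ProbabilityMeasure Data) :
    risk (linearLaplace w b) P ≤ ENNReal.ofReal ((∑ i, w i ^ 2) / 2 + 4 * b ^ 2) := by
  have := isProbabilityMeasure_laplace hb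
  have hinner (x : Fin n → Data) :
      ∫⁻ t, ENNReal.ofReal (|t - mean P| ^ 2) ∂(linearLaplace w b x)
        ≤ 2 * ENNReal.ofReal ((∑ i, w i * (x i : ℝ) - mean P) ^ 2)
          + ENNReal.ofReal (4 * b ^ 2) := by
    rw [linearLaplace_apply w hb, lintegral_map (by fun_prop) (by fun_prop)]
    set c := ∑ i, w i * (x i : ℝ)
    calc ∫⁻ z, ENNReal.ofReal (|c + z - mean P| ^ 2) ∂(laplace b)
        ≤ ∫⁻ z, (2 * ENNReal.ofReal ((c - mean P) ^ 2) + 2 * ENNReal.ofReal (z ^ 2))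
            ∂(laplace b) := by
          refine lintegral_mono fun z => ?_
          rw [show (2 : ℝ≥0∞) = ENNReal.ofReal 2 by simp, ← ENNReal.ofReal_mul (by norm_num),
            ← ENNReal.ofReal_mul (by norm_num), ← ENNReal.ofReal_add (by positivity)
              (by positivity), sq_abs]
          refine ENNReal.ofReal_le_ofReal ?_
          -- Using (x + z)² ≤ 2x² + 2z² costs a factor 2 but spares the cross term.
          nlinarith [sq_nonneg (c - mean P - z)]
      _ = _ := by
          rw [lintegral_add_left (by fun_prop), lintegral_const, measure_univ, mul_one,
            lintegral_const_mul _ (by fun_prop), lintegral_sq_laplace hb,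
            show (2 : ℝ≥0∞) = ENNReal.ofReal 2 by simp, ← ENNReal.ofReal_mul (by norm_num),
            ← ENNReal.ofReal_mul (by norm_num)]
          congr 2
          ring
  calc risk (linearLaplace w b) P
      ≤ ∫⁻ x, (2 * ENNReal.ofReal ((∑ i, w i * (x i : ℝ) - mean P) ^ 2)
          + ENNReal.ofReal (4 * b ^ 2)) ∂(Measure.pi fun _ : Fin n => (P : Measure Data)) :=
        lintegral_mono hinner
    _ ≤ 2 * ENNReal.ofReal ((∑ i, w i ^ 2) / 4) + ENNReal.ofReal (4 * b ^ 2) := by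
        rw [lintegral_add_left (by fun_prop), lintegral_const, measure_univ, mul_one,
          lintegral_const_mul _ (by fun_prop)]
        gcongr
        exact lintegral_sq_weighted_sum_sub_mean_le hw P
    _ = _ := by
        rw [show (2 : ℝ≥0∞) = ENNReal.ofReal 2 by simp, ← ENNReal.ofReal_mul (by norm_num),
          ← ENNReal.ofReal_add (by positivity) (by positivity)]
        congr 2
        ring

lemma risk_le_quarter_of_eq_dirac_zero {A : Kernel (Fin n → Data) ℝ}
    (hA : ∀ x, A x = Measure.dirac 0) (P : ProbabilityMeasure Data) :
    risk A P ≤ ENNReal.ofReal (1 / 4) := by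
  have hm := mean_mem_Icc P
  have h : ∀ x : Fin n → Data, ∫⁻ t, ENNReal.ofReal (|t - mean P| ^ 2) ∂(A x)
      = ENNReal.ofReal (mean P ^ 2) := by
    intro x
    rw [hA, lintegral_dirac' _ (by fun_prop)]
    simp
  simp only [risk, h, lintegral_const, measure_univ, mul_one]
  refine ENNReal.ofReal_le_ofReal ?_
  nlinarith [hm.1, hm.2]

end LinearLaplace

/-! ### The capping level -/

section CappingLevel

variable {n : ℕ}

/-- The quantity whose inverse enters `rate` at the index `k`. -/
noncomputable def effectiveSize (ε : Fin n → ℝ) (k : Fin (n + 1)) : ℝ :=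
  (n : ℝ) - (k : ℕ) + (∑ i ∈ Finset.univ.filter fun i : Fin n => (i : ℕ) < k, ε i) ^ 2

lemma rate_eq_iSup (ε : Fin n → ℝ) :
    rate ε = ⨆ k, (ENNReal.ofReal (effectiveSize ε k))⁻¹ := rfl

lemma effectiveSize_last (ε : Fin n → ℝ) :
    effectiveSize ε (Fin.last n) = (∑ i, ε i) ^ 2 := by
  simp [effectiveSize]

/-- A lower set of `Fin n` is an initial segment. -/
lemma filter_lt_card_eq {s : Finset (Fin n)} (hs : IsLowerSet (s : Set (Fin n))) :
    (Finset.univ.filter fun i : Fin n => (i : ℕ) < s.card) = s := by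
  set t := Finset.univ.filter fun i : Fin n => (i : ℕ) < s.card
  have hcard : t.card = s.card := by
    rw [Fin.card_filter_val_lt]
    exact min_eq_right (card_finset_fin_le s)
  have ht : IsLowerSet (t : Set (Fin n)) := by
    intro a b hba ha
    simp only [t, Finset.coe_filter, Finset.mem_univ, true_and, Set.mem_ofPred_eq] at ha ⊢
    exact lt_of_le_of_lt hba ha
  -- Lower sets of a linear order are nested, and nested finite sets of equal size coincide.
  rcases hs.total ht with h | h
  · exact (Finset.eq_of_subset_of_card_le (Finset.coe_subset.1 h) hcard.le).symm
  · exact Finset.eq_of_subset_of_card_le (Finset.coe_subset.1 h) hcard.ge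

/-- If the capped levels have small spread below the cap, some effective size is of the order
of their sum divided by the cap. -/
lemma exists_effectiveSize_le {ε : Fin n → ℝ} (hmono : Monotone ε) (h0 : ∀ i, 0 ≤ ε i)
    {τ : ℝ} (hτ : 0 < τ) (hf : ∑ i, min (ε i) τ * (τ - min (ε i) τ) ≤ 8) :
    ∃ k, effectiveSize ε k * τ ≤ 16 * ∑ i, min (ε i) τ := by
  set s : Finset (Fin n) := Finset.univ.filter fun i => ε i ≤ τ / 2
  have hs : IsLowerSet (s : Set (Fin n)) := by
    intro a b hba ha
    simp only [s, Finset.coe_filter, Finset.mem_univ, true_and, Set.mem_ofPred_eq] at ha ⊢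
    exact (hmono hba).trans ha
  have hcard : s.card ≤ n := card_finset_fin_le s
  have hm0 : ∀ i, 0 ≤ min (ε i) τ := fun i => le_min (h0 i) hτ.le
  have hms : ∀ i ∈ s, min (ε i) τ = ε i := by
    intro i hi
    have : ε i ≤ τ / 2 := (Finset.mem_filter.1 hi).2
    exact min_eq_left (by linarith)
  have hA0 : 0 ≤ ∑ i ∈ s, ε i := Finset.sum_nonneg fun i _ => h0 i
  -- On `s` the gap τ - ε i is at least τ/2, so the spread controls the sum of the small levels.
  have hA : (∑ i ∈ s, ε i) * (τ / 2) ≤ 8 := by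
    calc (∑ i ∈ s, ε i) * (τ / 2) = ∑ i ∈ s, ε i * (τ / 2) := Finset.sum_mul _ _ _
      _ ≤ ∑ i ∈ s, min (ε i) τ * (τ - min (ε i) τ) := by
          refine Finset.sum_le_sum fun i hi => ?_
          rw [hms i hi]
          have : ε i ≤ τ / 2 := (Finset.mem_filter.1 hi).2
          exact mul_le_mul_of_nonneg_left (by linarith) (h0 i)
      _ ≤ ∑ i, min (ε i) τ * (τ - min (ε i) τ) :=
          Finset.sum_le_sum_of_subset_of_nonneg (Finset.subset_univ s) fun i _ _ =>
            mul_nonneg (hm0 i) (by linarith [min_le_right (ε i) τ])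
      _ ≤ 8 := hf
  have hB : (sᶜ.card : ℝ) * (τ / 2) ≤ ∑ i ∈ sᶜ, min (ε i) τ := by
    rw [← nsmul_eq_mul]
    refine Finset.card_nsmul_le_sum _ _ _ fun i hi => ?_
    have : ¬ ε i ≤ τ / 2 := by simpa [s] using hi
    exact le_min (by linarith) (by linarith)
  have hsum : ∑ i, min (ε i) τ = ∑ i ∈ s, ε i + ∑ i ∈ sᶜ, min (ε i) τ := by
    rw [← Finset.sum_add_sum_compl s, Finset.sum_congr rfl hms]
  have hcompl : (sᶜ.card : ℝ) = (n : ℝ) - s.card := by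
    rw [Finset.card_compl, Fintype.card_fin, Nat.cast_sub hcard]
  have hB0 : 0 ≤ ∑ i ∈ sᶜ, min (ε i) τ := Finset.sum_nonneg fun i _ => hm0 i
  refine ⟨⟨s.card, Nat.lt_succ_of_le hcard⟩, ?_⟩
  rw [effectiveSize]
  simp only
  rw [filter_lt_card_eq hs, hsum, ← hcompl]
  -- With A and B the sums over `s` and its complement, `hA` gives A²τ ≤ 16A and `hB` gives (n - k)τ
  -- ≤ 2B.
  nlinarith

/-- At a suitable cap `τ`, the risk bound of the capped linear estimator times some effective
size is bounded by an absolute constant. -/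
lemma exists_capping_level {ε : Fin n → ℝ} (hmono : Monotone ε) (h0 : ∀ i, 0 ≤ ε i)
    (h1 : ∀ i, ε i ≤ 1) :
    ∃ τ : ℝ, 0 < τ ∧ ∃ k, ((∑ i, min (ε i) τ ^ 2) / 2 + 4) * effectiveSize ε k
      ≤ 72 * (∑ i, min (ε i) τ) ^ 2 := by
  set f : ℝ → ℝ := fun τ => ∑ i, min (ε i) τ * (τ - min (ε i) τ)
  have hfe (τ : ℝ) : f τ = τ * ∑ i, min (ε i) τ - ∑ i, min (ε i) τ ^ 2 := by
    rw [Finset.mul_sum, ← Finset.sum_sub_distrib]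
    exact Finset.sum_congr rfl fun i _ => by ring
  by_cases hf1 : f 1 ≤ 8
  · refine ⟨1, one_pos, ?_⟩
    have hm : ∀ i, min (ε i) 1 = ε i := fun i => min_eq_left (h1 i)
    have hQ : ∑ i, ε i ^ 2 ≤ ∑ i, ε i :=
      Finset.sum_le_sum fun i _ => by nlinarith [h0 i, h1 i]
    have hS0 : 0 ≤ ∑ i, ε i := Finset.sum_nonneg fun i _ => h0 i
    obtain ⟨k, hk⟩ := exists_effectiveSize_le hmono h0 one_pos hf1
    simp only [hm] at hk ⊢
    -- For a sum at most 1 the noise term dominates and k = n suffices; otherwise the 4 is absorbed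
    -- into 4 ∑ ε i.
    rcases le_total (∑ i, ε i) 1 with hS | hS
    · refine ⟨Fin.last n, ?_⟩
      rw [effectiveSize_last]
      exact mul_le_mul_of_nonneg_right (by linarith) (sq_nonneg _)
    · refine ⟨k, ?_⟩
      have hQ0 : 0 ≤ ∑ i, ε i ^ 2 := Finset.sum_nonneg fun i _ => sq_nonneg _
      calc ((∑ i, ε i ^ 2) / 2 + 4) * effectiveSize ε k
          ≤ ((∑ i, ε i ^ 2) / 2 + 4) * (16 * ∑ i, ε i) :=
            mul_le_mul_of_nonneg_left (by linarith) (by linarith)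
        _ ≤ (9 / 2 * ∑ i, ε i) * (16 * ∑ i, ε i) :=
            mul_le_mul_of_nonneg_right (by linarith) (by linarith)
        _ = 72 * (∑ i, ε i) ^ 2 := by ring
  · have hcont : ContinuousOn f (Set.Icc 0 1) := by
      refine Continuous.continuousOn ?_
      fun_prop
    have hf0 : f 0 = 0 := by simp [f, h0]
    obtain ⟨τ, ⟨hτ0, -⟩, hτ⟩ := intermediate_value_Icc zero_le_one hcont
      (show (8 : ℝ) ∈ Set.Icc (f 0) (f 1) from ⟨by rw [hf0]; norm_num, (not_le.1 hf1).le⟩)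
    have hτp : 0 < τ := by
      rcases hτ0.eq_or_lt with h | h
      · rw [← h, hf0] at hτ; norm_num at hτ
      · exact h
    obtain ⟨k, hk⟩ := exists_effectiveSize_le hmono h0 hτp hτ.le
    refine ⟨τ, hτp, k, ?_⟩
    rw [hfe] at hτ
    have hS0 : 0 ≤ ∑ i, min (ε i) τ := Finset.sum_nonneg fun i _ => le_min (h0 i) hτp.le
    -- The level 8 was chosen so that this identity is exact.
    have hQ : (∑ i, min (ε i) τ ^ 2) / 2 + 4 = (∑ i, min (ε i) τ) / 2 * τ := by linarith
    rw [hQ]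
    nlinarith

/-- The capped linear Laplace estimator attains the rate up to a constant. -/
lemma exists_isCappedLinearLaplace_risk_le {ε : Fin n → ℝ} (hmono : Monotone ε)
    (h0 : ∀ i, 0 ≤ ε i) (h1 : ∀ i, ε i ≤ 1) (hpos : ∃ i, 0 < ε i) :
    ∃ A ∈ privateEstimators ε, IsCappedLinearLaplace ε A ∧
      ∀ P : ProbabilityMeasure Data, risk A P ≤ ENNReal.ofReal 72 * rate ε := by
  obtain ⟨τ, hτ, k, hk⟩ := exists_capping_level hmono h0 h1
  have hm0 : ∀ i, 0 ≤ min (ε i) τ := fun i => le_min (h0 i) hτ.le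
  set η := ∑ i, min (ε i) τ
  have hη : 0 < η := by
    obtain ⟨i, hi⟩ := hpos
    exact Finset.sum_pos' (fun i _ => hm0 i) ⟨i, Finset.mem_univ i, lt_min hi hτ⟩
  have hb : 0 < 1 / η := by positivity
  have hw : ∑ i, min (ε i) τ / η = 1 := by rw [← Finset.sum_div, div_self hη.ne']
  refine ⟨linearLaplace (fun i => min (ε i) τ / η) (1 / η),
    ⟨isMarkovKernel_linearLaplace _ hb, isCentrallyDP_linearLaplace hb fun i => ?_⟩,
    ⟨fun i => min (ε i) τ / η, η, τ, hτ, hw, fun _ => rfl, hη, linearLaplace_apply _ hb⟩,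
    fun P => (risk_linearLaplace_le hw hb P).trans ?_⟩
  · rw [abs_of_nonneg (div_nonneg (hm0 i) hη.le), mul_one_div]
    exact div_le_div_of_nonneg_right (min_le_left _ _) hη.le
  · calc ENNReal.ofReal ((∑ i, (min (ε i) τ / η) ^ 2) / 2 + 4 * (1 / η) ^ 2)
        ≤ ENNReal.ofReal 72 / ENNReal.ofReal (effectiveSize ε k) := by
          -- The numerator 72 is nonzero and finite, so the effective size need not be shown
          -- positive.
          rw [ENNReal.le_div_iff_mul_le (.inr (by simp)) (.inr (by simp)),
            ← ENNReal.ofReal_mul (by positivity)]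
          refine ENNReal.ofReal_le_ofReal ?_
          have hx : (∑ i, (min (ε i) τ / η) ^ 2) / 2 + 4 * (1 / η) ^ 2
              = ((∑ i, min (ε i) τ ^ 2) / 2 + 4) / η ^ 2 := by
            simp only [div_pow]
            rw [← Finset.sum_div]
            field_simp
          rw [hx, div_mul_eq_mul_div, div_le_iff₀ (by positivity)]
          exact hk
      _ ≤ ENNReal.ofReal 72 * rate ε := by
          rw [div_eq_mul_inv, rate_eq_iSup]
          gcongr
          exact le_iSup (fun k => (ENNReal.ofReal (effectiveSize ε k))⁻¹) k

/-- If all levels vanish, the term k = n is 1/0 = ∞. -/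
lemma exists_pos_of_rate_lt_top {ε : Fin n → ℝ} (h0 : ∀ i, 0 ≤ ε i) (h : rate ε < ∞) :
    ∃ i, 0 < ε i := by
  by_contra! hε
  have hz : ∀ i, ε i = 0 := fun i => le_antisymm (hε i) (h0 i)
  refine h.not_ge ?_
  rw [rate_eq_iSup]
  refine le_iSup_of_le (Fin.last n) ?_
  rw [effectiveSize_last]
  simp [hz]

/-- With the zero estimator admitted, the truncated rate is attained up to a constant. -/
lemma exists_isCappedLinearLaplace_or_zero_risk_le {ε : Fin n → ℝ} (hmono : Monotone ε)
    (h0 : ∀ i, 0 ≤ ε i) (h1 : ∀ i, ε i ≤ 1) :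
    ∃ A ∈ privateEstimators ε, (IsCappedLinearLaplace ε A ∨ ∀ x, A x = Measure.dirac 0) ∧
      ∀ P : ProbabilityMeasure Data, risk A P ≤ ENNReal.ofReal 72 * min (rate ε) 1 := by
  rcases lt_or_ge (rate ε) 1 with h | h
  · obtain ⟨A, hA, hlin, hrisk⟩ := exists_isCappedLinearLaplace_risk_le hmono h0 h1
      (exists_pos_of_rate_lt_top h0 (h.trans ENNReal.one_lt_top))
    refine ⟨A, hA, .inl hlin, fun P => ?_⟩
    rw [min_eq_left h.le]
    exact hrisk P
  · have hA : ∀ x, Kernel.const (Fin n → Data) (Measure.dirac (0 : ℝ)) x = Measure.dirac 0 :=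
      fun x => Kernel.const_apply _ x
    refine ⟨Kernel.const _ (Measure.dirac 0), ⟨inferInstance, fun i S S' _ W _ => ?_⟩, .inr hA,
      fun P => (risk_le_quarter_of_eq_dirac_zero hA P).trans ?_⟩
    · rw [hA, hA]
      refine le_mul_of_one_le_left zero_le ?_
      rw [← ENNReal.ofReal_one]
      exact ENNReal.ofReal_le_ofReal (Real.one_le_exp (h0 i))
    · rw [min_eq_right h, mul_one]
      exact ENNReal.ofReal_le_ofReal (by norm_num)

lemma le_mul_log_add_one (hn : 0 < n) : (72 : ℝ) ≤ 144 * Real.log ((n : ℝ) + 1) := by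
  have h1 : (1 : ℝ) ≤ n := by exact_mod_cast hn
  have h2 : Real.log 2 ≤ Real.log ((n : ℝ) + 1) :=
    Real.log_le_log (by norm_num) (by linarith)
  linarith [Real.log_two_gt_d9]

end CappingLevel

/-! ### The two-point lower bound -/

section LowerBound

/-- The law of a random bit whose sign has mean `δ`. -/
noncomputable def bitLaw (δ : ℝ) : Measure Bool :=
  ENNReal.ofReal ((1 + δ) / 2) • Measure.dirac true
    + ENNReal.ofReal ((1 - δ) / 2) • Measure.dirac false

lemma bitLaw_singleton (δ : ℝ) (c : Bool) :
    bitLaw δ {c} = ENNReal.ofReal ((1 + δ * bitSign c) / 2) := by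
  cases c <;> simp [bitLaw, bitSign, sub_eq_add_neg]

lemma isProbabilityMeasure_bitLaw {δ : ℝ} (hδ : |δ| ≤ 1) : IsProbabilityMeasure (bitLaw δ) := by
  obtain ⟨h1, h2⟩ := abs_le.1 hδ
  refine ⟨?_⟩
  simp only [bitLaw, Measure.add_apply, Measure.smul_apply, measure_univ, smul_eq_mul, mul_one]
  rw [← ENNReal.ofReal_add (by linarith) (by linarith), ← ENNReal.ofReal_one]
  congr 1
  ring

/-- The end point of the data space with the given sign. -/
noncomputable def endPoint (c : Bool) : Data :=
  ⟨bitSign c / 2, by cases c <;> norm_num [bitSign]⟩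

lemma coe_endPoint (c : Bool) : (endPoint c : ℝ) = bitSign c / 2 := rfl

/-- The law on the two end points of the data space with mean `δ / 2`. -/
noncomputable def twoPointLaw (δ : ℝ) (hδ : |δ| ≤ 1) : ProbabilityMeasure Data :=
  ⟨(bitLaw δ).map endPoint, by
    have := isProbabilityMeasure_bitLaw hδ
    exact Measure.isProbabilityMeasure_map (measurable_of_finite _).aemeasurable⟩

lemma coe_twoPointLaw {δ : ℝ} (hδ : |δ| ≤ 1) :
    (twoPointLaw δ hδ : Measure Data) = (bitLaw δ).map endPoint := rfl

lemma mean_twoPointLaw {δ : ℝ} (hδ : |δ| ≤ 1) : mean (twoPointLaw δ hδ) = δ / 2 := by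
  have := isProbabilityMeasure_bitLaw hδ
  obtain ⟨h1, h2⟩ := abs_le.1 hδ
  rw [mean, coe_twoPointLaw, integral_map (measurable_of_finite _).aemeasurable (by fun_prop),
    integral_fintype .of_finite]
  simp only [Fintype.sum_bool, measureReal_def, bitLaw_singleton, coe_endPoint, bitSign, if_true,
    Bool.false_eq_true, if_false, smul_eq_mul]
  rw [ENNReal.toReal_ofReal (by linarith), ENNReal.toReal_ofReal (by linarith)]
  ring

variable {n : ℕ}

/-- The data set of end points with the given signs. -/
noncomputable def endPoints (b : Fin n → Bool) : Fin n → Data := fun i => endPoint (b i)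

/-- The sample is the image of independent bits, which reduces the risk to a finite weighted sum
over sign vectors. -/
lemma risk_twoPointLaw (A : Kernel (Fin n → Data) ℝ) {δ : ℝ} (hδ : |δ| ≤ 1) :
    risk A (twoPointLaw δ hδ)
      = ∑ b, (∫⁻ t, ENNReal.ofReal (|t - δ / 2| ^ 2) ∂(A (endPoints b)))
          * ENNReal.ofReal (bitWeight (fun _ => δ) b) := by
  have := isProbabilityMeasure_bitLaw hδ
  have hmap : (Measure.pi fun _ : Fin n => (twoPointLaw δ hδ : Measure Data))
      = (Measure.pi fun _ : Fin n => bitLaw δ).map endPoints := by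
    have : IsProbabilityMeasure ((bitLaw δ).map endPoint) :=
      Measure.isProbabilityMeasure_map (measurable_of_finite _).aemeasurable
    exact (Measure.pi_map_pi fun _ => (measurable_of_finite endPoint).aemeasurable).symm
  have hmeas : Measurable fun x : Fin n → Data =>
      ∫⁻ t, ENNReal.ofReal (|t - δ / 2| ^ 2) ∂(A x) :=
    Measurable.lintegral_kernel (by fun_prop)
  rw [risk, mean_twoPointLaw, hmap, lintegral_map hmeas (measurable_of_finite _),
    lintegral_fintype]
  refine Finset.sum_congr rfl fun b _ => ?_
  rw [Measure.pi_singleton, bitWeight, ENNReal.ofReal_prod_of_nonneg]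
  · simp only [bitLaw_singleton]
  · intro i _
    have h : |δ * bitSign (b i)| ≤ 1 := by rwa [abs_mul, abs_bitSign, mul_one]
    linarith [(abs_le.1 h).1]

/-- If the outputs in `W` are at distance at least `ρ` from the mean, the risk is at least
`ρ ^ 2` times the probability of `W`. -/
lemma ofReal_mul_bitExp_le_risk (A : Kernel (Fin n → Data) ℝ) [IsMarkovKernel A] {δ : ℝ}
    (hδ : |δ| ≤ 1) {ρ : ℝ} (hρ : 0 ≤ ρ) {W : Set ℝ} (hW : MeasurableSet W)
    (h : ∀ t ∈ W, ρ ≤ |t - δ / 2|) :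
    ENNReal.ofReal (ρ ^ 2 * bitExp (fun _ => δ) fun b => (A (endPoints b)).real W)
      ≤ risk A (twoPointLaw δ hδ) := by
  rw [risk_twoPointLaw, bitExp, Finset.mul_sum, ENNReal.ofReal_sum_of_nonneg]
  · refine Finset.sum_le_sum fun b _ => ?_
    rw [mul_comm (bitWeight _ _), ← mul_assoc, ENNReal.ofReal_mul (by positivity)]
    gcongr
    rw [ENNReal.ofReal_mul (by positivity), ofReal_measureReal, ← setLIntegral_const]
    refine (setLIntegral_mono' hW fun t ht => ENNReal.ofReal_le_ofReal ?_).trans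
      (setLIntegral_le_lintegral W _)
    exact pow_le_pow_left₀ hρ (h t ht) 2
  · intro b _
    exact mul_nonneg (sq_nonneg _)
      (mul_nonneg (bitWeight_nonneg (fun _ => hδ) b) measureReal_nonneg)

lemma IsCentrallyDP.abs_measureReal_sub_le {ε : Fin n → ℝ} {A : Kernel (Fin n → Data) ℝ}
    [IsMarkovKernel A] (hA : IsCentrallyDP ε A) {i : Fin n} (h0 : 0 ≤ ε i) (h1 : ε i ≤ 1)
    {S S' : Fin n → Data} (hS : ∀ j, j ≠ i → S j = S' j) {W : Set ℝ} (hW : MeasurableSet W) :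
    |(A S).real W - (A S').real W| ≤ 2 * ε i := by
  have hexp : Real.exp (ε i) - 1 ≤ 2 * ε i := by
    have := Real.abs_exp_sub_one_le (x := ε i) (by rwa [abs_of_nonneg h0])
    rw [abs_of_nonneg h0] at this
    exact (le_abs_self _).trans this
  have key : ∀ T T' : Fin n → Data, (∀ j, j ≠ i → T j = T' j) →
      (A T).real W - (A T').real W ≤ 2 * ε i := by
    intro T T' hT
    have h := ENNReal.toReal_mono (ENNReal.mul_ne_top ENNReal.ofReal_ne_top
      (measure_ne_top _ _)) (hA i T T' hT W hW)
    rw [ENNReal.toReal_mul, ENNReal.toReal_ofReal (Real.exp_pos _).le] at h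
    have h' : (A T).real W ≤ Real.exp (ε i) * (A T').real W := h
    have hle : (A T').real W ≤ 1 := measureReal_le_one
    have hnn : 0 ≤ (A T').real W := measureReal_nonneg
    nlinarith [Real.one_le_exp h0]
  rw [abs_le]
  exact ⟨by linarith [key S' S fun j hj => (hS j hj).symm], key S S' hS⟩

lemma one_add_pow_sub_one_le {x : ℝ} (hx : 0 ≤ x) (m : ℕ) (h : m * x ≤ 1) :
    (1 + x) ^ m - 1 ≤ 2 * (m * x) := by
  have hmx : 0 ≤ m * x := by positivity
  have h1 : (1 + x) ^ m ≤ Real.exp (m * x) := by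
    rw [Real.exp_nat_mul]
    exact pow_le_pow_left₀ (by linarith) (by linarith [Real.add_one_le_exp x]) m
  have h2 := Real.abs_exp_sub_one_le (x := m * x) (by rwa [abs_of_nonneg hmx])
  rw [abs_of_nonneg hmx] at h2
  linarith [le_abs_self (Real.exp (m * x) - 1)]

/-- No private estimator has error below the order of the inverse effective size. -/
lemma ofReal_le_iSup_risk {ε : Fin n → ℝ} (h0 : ∀ i, 0 ≤ ε i) (h1 : ∀ i, ε i ≤ 1)
    {A : Kernel (Fin n → Data) ℝ} (hA : A ∈ privateEstimators ε) (k : Fin (n + 1)) :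
    ENNReal.ofReal (1 / 4096 / max 1 (effectiveSize ε k))
      ≤ ⨆ P ∈ (Set.univ : Set (ProbabilityMeasure Data)), risk A P := by
  have : IsMarkovKernel A := hA.1
  set s : Finset (Fin n) := Finset.univ.filter fun i : Fin n => (i : ℕ) < k
  set D := effectiveSize ε k
  have hk : (k : ℕ) ≤ n := Nat.le_of_lt_succ k.2
  have hcard : (sᶜ.card : ℝ) = (n : ℝ) - (k : ℕ) := by
    rw [Finset.card_compl, Fintype.card_fin, Fin.card_filter_val_lt, min_eq_right hk,
      Nat.cast_sub hk]
  have hD : D = sᶜ.card + (∑ i ∈ s, ε i) ^ 2 := by rw [hcard]; rfl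
  have hmax : 0 < max 1 D := lt_max_of_lt_left one_pos
  -- The 8 yields δ ∑ ε i ≤ 1/8 over `s` and (n - k) δ² ≤ 1/64; the maximum with 1 keeps δ ≤ 1.
  set δ := 1 / (8 * Real.sqrt (max 1 D))
  have hδ0 : 0 ≤ δ := by positivity
  have hδsq : δ ^ 2 * max 1 D = 1 / 64 := by
    rw [div_pow, mul_pow, Real.sq_sqrt hmax.le]
    field_simp
    norm_num
  have hδD : δ ^ 2 * D ≤ 1 / 64 :=
    (mul_le_mul_of_nonneg_left (le_max_right 1 D) (sq_nonneg δ)).trans hδsq.le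
  have hδ64 : δ ^ 2 ≤ 1 / 64 := by nlinarith [le_max_left 1 D, sq_nonneg δ]
  have hδ1 : δ ≤ 1 := by nlinarith
  have hδabs : |δ| ≤ 1 := by rwa [abs_of_nonneg hδ0]
  have hs0 : 0 ≤ ∑ i ∈ s, ε i := Finset.sum_nonneg fun i _ => h0 i
  have hδs : δ * ∑ i ∈ s, ε i ≤ 1 / 8 := by
    refine abs_le_of_sq_le_sq' ?_ (by norm_num) |>.2
    have : 0 ≤ δ ^ 2 * (sᶜ.card : ℝ) := by positivity
    rw [hD] at hδD
    nlinarith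
  have hδm : sᶜ.card * δ ^ 2 ≤ 1 / 64 := by
    rw [hD] at hδD
    nlinarith [mul_nonneg (sq_nonneg δ) (sq_nonneg (∑ i ∈ s, ε i))]
  -- The threshold is midway between the means 0 and δ/2, so each wrong side costs an error of at
  -- least δ/4.
  set W : Set ℝ := Set.Ici (δ / 4)
  set φ : (Fin n → Bool) → ℝ := fun b => (A (endPoints b)).real W
  have hφ1 : ∀ b, |φ b| ≤ 1 := fun b => by
    rw [abs_of_nonneg measureReal_nonneg]; exact measureReal_le_one
  have hosc : ∀ i ∈ s, ∀ b c, |φ b - φ (Function.update b i c)| ≤ 2 * ε i := by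
    intro i _ b c
    refine hA.2.abs_measureReal_sub_le (h0 i) (h1 i) (fun j hj => ?_) measurableSet_Ici
    simp [endPoints, hj]
  -- The budget is 1/8 from privacy, 1/8 from the quadratic inequality and 4/64 from the second
  -- moment.
  have hdiff : bitExp (fun _ => δ) φ - bitExp 0 φ ≤ 1 / 2 := by
    have hc := bitExp_const_sub_le hδ0 hδ1 hφ1 s hosc
    have hp := one_add_pow_sub_one_le (sq_nonneg δ) sᶜ.card (by linarith)
    rw [← Finset.mul_sum] at hc
    linarith
  have h00 : |(0 : ℝ)| ≤ 1 := by norm_num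
  have hrisk0 : ENNReal.ofReal ((δ / 4) ^ 2 * bitExp 0 φ) ≤ risk A (twoPointLaw 0 h00) := by
    refine ofReal_mul_bitExp_le_risk A h00 (by positivity) measurableSet_Ici fun t ht => ?_
    have : δ / 4 ≤ t := ht
    rw [zero_div, sub_zero]
    exact this.trans (le_abs_self t)
  have hrisk1 : ENNReal.ofReal ((δ / 4) ^ 2 * (1 - bitExp (fun _ => δ) φ))
      ≤ risk A (twoPointLaw δ hδabs) := by
    have hcompl : 1 - bitExp (fun _ => δ) φ
        = bitExp (fun _ => δ) fun b => (A (endPoints b)).real Wᶜ := by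
      have hsum := sum_bitWeight fun _ : Fin n => δ
      simp only [bitExp, probReal_compl_eq_one_sub (s := W) measurableSet_Ici, mul_sub, mul_one,
        Finset.sum_sub_distrib, hsum]
      rfl
    rw [hcompl]
    refine ofReal_mul_bitExp_le_risk A hδabs (by positivity) measurableSet_Ici.compl
      fun t ht => ?_
    have : t < δ / 4 := not_le.1 ht
    rw [abs_sub_comm]
    exact le_trans (by linarith) (le_abs_self (δ / 2 - t))
  have hval : 1 / 4096 / max 1 D = (δ / 4) ^ 2 * (1 / 4) := by
    rw [div_eq_iff hmax.ne']
    linarith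
  rw [hval]
  rcases le_total (1 / 4) (bitExp 0 φ) with h | h
  · exact (ENNReal.ofReal_le_ofReal (by gcongr)).trans
      (hrisk0.trans (le_biSup (fun P => risk A P) (Set.mem_univ _)))
  · have h' : 1 / 4 ≤ 1 - bitExp (fun _ => δ) φ := by linarith
    exact (ENNReal.ofReal_le_ofReal (by gcongr)).trans
      (hrisk1.trans (le_biSup (fun P => risk A P) (Set.mem_univ _)))

lemma min_rate_one_le_minimaxRisk {ε : Fin n → ℝ} (h0 : ∀ i, 0 ≤ ε i) (h1 : ∀ i, ε i ≤ 1) :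
    ENNReal.ofReal (1 / 4096) * min (rate ε) 1 ≤ minimaxRisk Set.univ ε := by
  refine le_iInf₂ fun A hA => ?_
  rw [rate_eq_iSup, iSup_inf_eq, ENNReal.mul_iSup]
  refine iSup_le fun k => le_trans (le_of_eq ?_) (ofReal_le_iSup_risk h0 h1 hA k)
  -- Truncating the rate at 1 is the same as replacing D by max(1, D), because inversion is
  -- antitone.
  have hinv : min (ENNReal.ofReal (effectiveSize ε k))⁻¹ 1
      = (ENNReal.ofReal (max 1 (effectiveSize ε k)))⁻¹ := by
    have h : Antitone fun x : ℝ≥0∞ => x⁻¹ := fun _ _ h => ENNReal.inv_le_inv.2 h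
    rw [ENNReal.ofReal_max, h.map_max, ENNReal.ofReal_one, inv_one, min_comm]
  rw [hinv, ENNReal.ofReal_div_of_pos (lt_max_of_lt_left one_pos)]
  exact (div_eq_mul_inv _ _).symm

end LowerBound

end CentralDP

theorem theorem1 :
    -- lower bound, over the family of all distributions on the data space
    (∃ c_l : ℝ, 0 < c_l ∧ ∀ (n : ℕ) (ε : Fin n → ℝ), 0 < n → Monotone ε →
      (∀ i, 0 ≤ ε i) → (∀ i, ε i ≤ 1) →
      ENNReal.ofReal c_l * min (CentralDP.rate ε) 1 ≤ CentralDP.minimaxRisk Set.univ ε) ∧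
    -- upper bound
    (∃ c_u : ℝ, 0 < c_u ∧ ∀ (n : ℕ) (ε : Fin n → ℝ), 0 < n → Monotone ε →
      (∀ i, 0 ≤ ε i) → (∀ i, ε i ≤ 1) →
      -- by a capped weighted average plus Laplace noise, as soon as one level is positive
      ((∃ i, 0 < ε i) →
        ∃ A ∈ CentralDP.privateEstimators ε, CentralDP.IsCappedLinearLaplace ε A ∧
          ∀ P : ProbabilityMeasure CentralDP.Data, CentralDP.risk A P ≤
            ENNReal.ofReal (c_u * Real.log ((n : ℝ) + 1)) * CentralDP.rate ε) ∧
      -- and truncated at one, if the estimator that is identically zero is also admitted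
      (∃ A ∈ CentralDP.privateEstimators ε,
        (CentralDP.IsCappedLinearLaplace ε A ∨ ∀ x, A x = Measure.dirac 0) ∧
          ∀ P : ProbabilityMeasure CentralDP.Data, CentralDP.risk A P ≤
            ENNReal.ofReal (c_u * Real.log ((n : ℝ) + 1)) * min (CentralDP.rate ε) 1)) := by
  refine ⟨⟨1 / 4096, by norm_num, fun n ε _ _ h0 h1 => CentralDP.min_rate_one_le_minimaxRisk h0 h1⟩,
    144, by norm_num, fun n ε hn hmono h0 h1 => ?_⟩
  have hc : ENNReal.ofReal 72 ≤ ENNReal.ofReal (144 * Real.log ((n : ℝ) + 1)) :=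
    ENNReal.ofReal_le_ofReal (CentralDP.le_mul_log_add_one hn)
  constructor
  · intro hpos
    obtain ⟨A, hA, hlin, hrisk⟩ :=
      CentralDP.exists_isCappedLinearLaplace_risk_le hmono h0 h1 hpos
    exact ⟨A, hA, hlin, fun P => (hrisk P).trans (mul_le_mul_left hc _)⟩
  · obtain ⟨A, hA, hlin, hrisk⟩ :=
      CentralDP.exists_isCappedLinearLaplace_or_zero_risk_le hmono h0 h1
    exact ⟨A, hA, hlin, fun P => (hrisk P).trans (mul_le_mul_left hc _)⟩
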